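/- Let $\mathbb{K}$ be $\mathbb{R}$ or $\mathbb{C}$, let $\mathcal{A}=(A_1,\dots,A_K)$ be a finite collection of $n\times n$ matrices over $\mathbb{K}$, and for an invertible matrix $U\in\mathbb{K}^{n\times n}$ put $$f_{\mathcal{A}}(U)=\frac12\sum_{k=1}^K\sum_{i\neq j}\bigl|(U^{-1}A_kU)_{ij}\bigr|^2 .$$ Then the following two statements are equivalent. (i) For every nonzero non-invertible matrix $U_0\in\mathbb{K}^{n\times n}$, $$\lim_{U\to U_0,\ U\in\mathbb{K}^{n\times n}\text{ invertible}} f_{\mathcal{A}}(U)=+\infty .$$ (ii) The matrices $A_1,\dots,A_K$ have no common nontrivial invariant subspace, that is, there is no linear subspace $W\subseteq\mathbb{K}^n$ with $W\neq\{0\}$, $W\neq\mathbb{K}^n$ and $A_kW\subseteq W$ for all $k=1,\dots,K$. -/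

import Mathlib

open Filter Topology

/-- The joint diagonalization functional
`f_A(U) = 1/2 * ∑ k, ∑ i ≠ j, |(U⁻¹ A_k U) i j| ^ 2`. It is meaningful for invertible `U` only
(Mathlib's `U⁻¹` is `0` when `U` is not invertible). -/
noncomputable def jointDiagFunctional {𝕜 : Type*} [RCLike 𝕜] {n K : ℕ}
    (A : Fin K → Matrix (Fin n) (Fin n) 𝕜) (U : Matrix (Fin n) (Fin n) 𝕜) : ℝ :=
  (1 / 2 : ℝ) * ∑ k : Fin K, ∑ i : Fin n, ∑ j : Fin n,
    if i ≠ j then ‖(U⁻¹ * A k * U) i j‖ ^ 2 else 0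

/-- The matrices `A_k` have a common nontrivial invariant subspace: a linear subspace `W` of `𝕜ⁿ`
with `W ≠ 0`, `W ≠ 𝕜ⁿ` and `A_k W ⊆ W` for every `k`. -/
def HasCommonNontrivialInvariantSubspace {𝕜 : Type*} [RCLike 𝕜] {n K : ℕ}
    (A : Fin K → Matrix (Fin n) (Fin n) 𝕜) : Prop :=
  ∃ W : Submodule 𝕜 (Fin n → 𝕜), W ≠ ⊥ ∧ W ≠ ⊤ ∧
    ∀ k : Fin K, W ∈ Module.End.invtSubmodule (Matrix.toLin' (A k))

/-! If `f` does not blow up at a singular `U₀ ≠ 0`, the off-diagonal entries of `B = U⁻¹ A_k U` stay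
bounded for some invertible `U` arbitrarily near `U₀`, so they converge along an ultrafilter.
Passing to the limit in `A_k U = U B`, column by column, shows that `range U₀` is invariant under
every `A_k`; it is nontrivial because `U₀` is nonzero and singular. Conversely, a projection `E`
onto a common invariant subspace is a singular point at which `f` has a finite limit along the curve
`E + t (1 - E)`, `t → 0`. -/

theorem norm_sq_le_jointDiagFunctional {𝕜 : Type*} [RCLike 𝕜] {n K : ℕ}
    (A : Fin K → Matrix (Fin n) (Fin n) 𝕜) (U : Matrix (Fin n) (Fin n) 𝕜)
    (k : Fin K) {i j : Fin n} (hij : i ≠ j) :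
    ‖(U⁻¹ * A k * U) i j‖ ^ 2 ≤ 2 * jointDiagFunctional A U := by
  have h0 : ∀ (k : Fin K) (i j : Fin n),
      0 ≤ if i ≠ j then ‖(U⁻¹ * A k * U) i j‖ ^ 2 else 0 := by
    intro k i j; split_ifs <;> positivity
  have h1 := Finset.single_le_sum (f := fun j => if i ≠ j then ‖(U⁻¹ * A k * U) i j‖ ^ 2 else 0)
    (fun j _ => h0 k i j) (Finset.mem_univ j)
  have h2 := Finset.single_le_sum
    (f := fun i => ∑ j, if i ≠ j then ‖(U⁻¹ * A k * U) i j‖ ^ 2 else 0)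
    (fun i _ => Finset.sum_nonneg fun j _ => h0 k i j) (Finset.mem_univ i)
  have h3 := Finset.single_le_sum
    (f := fun k => ∑ i, ∑ j, if i ≠ j then ‖(U⁻¹ * A k * U) i j‖ ^ 2 else 0)
    (fun k _ => Finset.sum_nonneg fun i _ => Finset.sum_nonneg fun j _ => h0 k i j)
    (Finset.mem_univ k)
  simp only [if_pos hij] at h1
  unfold jointDiagFunctional
  linarith

/-- If `U * B = A * U` along an ultrafilter on which `U → U₀` and the off-diagonal entries of `B`
converge, then every column of `A * U₀` is in the range of `U₀`. The diagonal entries of `B` need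
not converge: where the limiting column of `U₀` vanishes there is nothing to prove. -/
theorem exists_col_mul_eq_mulVec {ι 𝕜 : Type*} [RCLike 𝕜] {m : Type*} [Fintype m]
    [DecidableEq m] {F : Filter ι} [F.NeBot] {U B : ι → Matrix m m 𝕜}
    {A U₀ : Matrix m m 𝕜} (hU : Tendsto U F (𝓝 U₀)) (hAB : ∀ᶠ x in F, A * U x = U x * B x)
    (j : m) (hB : ∀ i, i ≠ j → ∃ b, Tendsto (fun x => B x i j) F (𝓝 b)) :
    ∃ v : m → 𝕜, ∀ r, (A * U₀) r j = (U₀.mulVec v) r := by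
  have hent : ∀ r i, Tendsto (fun x => U x r i) F (𝓝 (U₀ r i)) := fun r i =>
    ((continuous_apply_apply r i).tendsto U₀).comp hU
  have hAU : ∀ r, Tendsto (fun x => (A * U x) r j) F (𝓝 ((A * U₀) r j)) := fun r => by
    simp only [Matrix.mul_apply]
    exact tendsto_finsetSum _ fun i _ => (hent i j).const_mul _
  by_cases hz : ∀ r, U₀ r j = 0
  · refine ⟨0, fun r => ?_⟩
    simp [Matrix.mul_apply, hz]
  push Not at hz
  obtain ⟨r₀, hr₀⟩ := hz
  choose! b hb using hB
  -- The functional does not control `B j j`; row `r₀` of `A U = U B` is solved for it, dividing by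
  -- `U r₀ j`, whose limit is nonzero.
  have hjj : ∃ c, Tendsto (fun x => B x j j) F (𝓝 c) := by
    have h1 : Tendsto (fun x => ((A * U x) r₀ j -
        ∑ i ∈ Finset.univ.erase j, U x r₀ i * B x i j) / U x r₀ j) F
        (𝓝 (((A * U₀) r₀ j - ∑ i ∈ Finset.univ.erase j, U₀ r₀ i * b i) / U₀ r₀ j)) :=
      ((hAU r₀).sub (tendsto_finsetSum _ fun i hi =>
        (hent r₀ i).mul (hb i (Finset.ne_of_mem_erase hi)))).div (hent r₀ j) hr₀
    refine ⟨_, h1.congr' ?_⟩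
    filter_upwards [hAB, (hent r₀ j).eventually_ne hr₀] with x hx hne
    rw [hx, Matrix.mul_apply, ← Finset.add_sum_erase _ _ (Finset.mem_univ j), add_sub_cancel_right,
      mul_div_cancel_left₀ _ hne]
  obtain ⟨c, hc⟩ := hjj
  refine ⟨Function.update b j c, fun r => ?_⟩
  have hlim : ∀ i, Tendsto (fun x => B x i j) F (𝓝 (Function.update b j c i)) := fun i => by
    by_cases hi : i = j
    · subst hi; simpa using hc
    · simpa [hi] using hb i hi
  refine tendsto_nhds_unique_of_eventuallyEq (hAU r)
    (tendsto_finsetSum Finset.univ fun i _ => (hent r i).mul (hlim i)) ?_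
  filter_upwards [hAB] with x hx
  rw [hx, Matrix.mul_apply]

theorem range_mem_invtSubmodule_of_cols {𝕜 : Type*} [Field 𝕜] {m : Type*} [Fintype m]
    [DecidableEq m] {A U₀ : Matrix m m 𝕜}
    (h : ∀ j, ∃ v : m → 𝕜, ∀ r, (A * U₀) r j = (U₀.mulVec v) r) :
    LinearMap.range (Matrix.toLin' U₀) ∈ Module.End.invtSubmodule (Matrix.toLin' A) := by
  choose v hv using h
  have hX : A * U₀ = U₀ * Matrix.of fun i j => v j i := by
    ext r j
    rw [hv, Matrix.mul_apply]
    rfl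
  rw [Module.End.mem_invtSubmodule]
  rintro _ ⟨y, rfl⟩
  refine ⟨(Matrix.of fun i j => v j i).mulVec y, ?_⟩
  simp only [Matrix.toLin'_apply, Matrix.mulVec_mulVec, hX]

theorem tendsto_jointDiagFunctional_of_not_hasCommonNontrivialInvariantSubspace
    {𝕜 : Type*} [RCLike 𝕜] {n K : ℕ} {A : Fin K → Matrix (Fin n) (Fin n) 𝕜}
    (hA : ¬ HasCommonNontrivialInvariantSubspace A) {U₀ : Matrix (Fin n) (Fin n) 𝕜}
    (h0 : U₀ ≠ 0) (hU₀ : ¬ IsUnit U₀) :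
    Tendsto (jointDiagFunctional A) (𝓝[{U | IsUnit U}] U₀) atTop := by
  by_contra hnot
  rw [tendsto_atTop] at hnot
  push Not at hnot
  obtain ⟨C, hC⟩ := hnot
  -- On an ultrafilter, bounded scalars converge by compactness, with no subsequences to extract.
  obtain ⟨F, hFle⟩ := @Ultrafilter.exists_le _ _ (frequently_iff_neBot.1 hC)
  obtain ⟨hF, hFC⟩ := le_inf_iff.1 hFle
  have hFU : Tendsto id (F : Filter (Matrix (Fin n) (Fin n) 𝕜)) (𝓝 U₀) :=
    hF.trans nhdsWithin_le_nhds
  have hunit : ∀ᶠ U in (F : Filter (Matrix (Fin n) (Fin n) 𝕜)), IsUnit U :=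
    hF self_mem_nhdsWithin
  have hbd : ∀ᶠ U in (F : Filter (Matrix (Fin n) (Fin n) 𝕜)), jointDiagFunctional A U ≤ C :=
    mem_of_superset (le_principal_iff.1 hFC) fun U hU =>
      show jointDiagFunctional A U ≤ C from le_of_lt hU
  refine hA ⟨LinearMap.range (Matrix.toLin' U₀), ?_, ?_, fun k => ?_⟩
  · rw [Ne, LinearMap.range_eq_bot]
    exact fun h => h0 (by simpa using h)
  · rw [Ne, LinearMap.range_eq_top]
    intro h
    exact hU₀ (Matrix.mulVec_surjective_iff_isUnit.1 h)
  · refine range_mem_invtSubmodule_of_cols fun j =>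
      exists_col_mul_eq_mulVec (B := fun U => U⁻¹ * A k * U) hFU ?_ j fun i hij => ?_
    · filter_upwards [hunit] with U hU
      rw [Matrix.isUnit_iff_isUnit_det] at hU
      rw [id, ← Matrix.mul_assoc, ← Matrix.mul_assoc, Matrix.mul_nonsing_inv _ hU, Matrix.one_mul]
    · have hmem : ∀ᶠ U in (F : Filter (Matrix (Fin n) (Fin n) 𝕜)),
          (U⁻¹ * A k * U) i j ∈ Metric.closedBall (0 : 𝕜) √(2 * C) := by
        filter_upwards [hbd] with U hU
        rw [mem_closedBall_zero_iff]
        exact Real.le_sqrt_of_sq_le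
          ((norm_sq_le_jointDiagFunctional A U k hij).trans (by linarith))
      obtain ⟨b, -, hb⟩ := (isCompact_closedBall (0 : 𝕜) √(2 * C)).ultrafilter_le_nhds
        (F.map fun U : Matrix (Fin n) (Fin n) 𝕜 => (U⁻¹ * A k * U) i j)
          (le_principal_iff.2 hmem)
      exact ⟨b, hb⟩

/-- `E` projects onto `W` along some complement; invariance of `W` is the vanishing of the
lower-left block `(1 - E) A E`. -/
theorem exists_idempotent_of_mem_invtSubmodule {𝕜 : Type*} [Field 𝕜] {m : Type*} [Fintype m]
    [DecidableEq m] {W : Submodule 𝕜 (m → 𝕜)} (hbot : W ≠ ⊥) (htop : W ≠ ⊤) :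
    ∃ E : Matrix m m 𝕜, E * E = E ∧ E ≠ 0 ∧ E ≠ 1 ∧
      ∀ A : Matrix m m 𝕜, W ∈ Module.End.invtSubmodule (Matrix.toLin' A) →
        (1 - E) * A * E = 0 := by
  obtain ⟨p, hp⟩ := W.subtype.exists_leftInverse_of_injective W.ker_subtype
  have hpW : ∀ w : W, p w = w := fun w => LinearMap.congr_fun hp w
  set E : Matrix m m 𝕜 := LinearMap.toMatrix' (W.subtype ∘ₗ p) with hEdef
  have hE : ∀ x, E.mulVec x = (p x : m → 𝕜) := fun x => by
    rw [← Matrix.toLin'_apply, hEdef, Matrix.toLin'_toMatrix']; rfl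
  have hEW : ∀ x ∈ W, E.mulVec x = x := fun x hx => by rw [hE, hpW ⟨x, hx⟩]
  have hext : ∀ M N : Matrix m m 𝕜, (∀ x, M.mulVec x = N.mulVec x) → M = N := fun M N h =>
    Matrix.toLin'.injective (LinearMap.ext fun x => by simpa using h x)
  refine ⟨E, hext _ _ fun x => ?_, fun h => hbot ?_, fun h => htop ?_, fun A hA => ?_⟩
  · rw [← Matrix.mulVec_mulVec]
    exact hEW _ (by rw [hE]; exact (p x).2)
  · rw [Submodule.eq_bot_iff]
    intro x hx
    rw [← hEW x hx, h, Matrix.zero_mulVec]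
  · rw [Submodule.eq_top_iff']
    intro x
    have := (p x).2
    rwa [← hE, h, Matrix.one_mulVec] at this
  · rw [Module.End.mem_invtSubmodule] at hA
    refine hext _ _ fun x => ?_
    have hx : A.mulVec (E.mulVec x) ∈ W := hA (by rw [hE]; exact (p x).2)
    rw [← Matrix.mulVec_mulVec, ← Matrix.mulVec_mulVec, Matrix.sub_mulVec, Matrix.one_mulVec,
      hEW _ hx, sub_self, Matrix.zero_mulVec]

/-- Conjugation by `E + t (1 - E)` fixes the diagonal blocks of `A k`, scales `E A (1 - E)` by `t`
and `(1 - E) A E` by `t⁻¹`. The latter block is zero, so nothing diverges as `t → 0`. -/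
theorem not_tendsto_jointDiagFunctional_of_idempotent
    {𝕜 : Type*} [RCLike 𝕜] {n K : ℕ} {A : Fin K → Matrix (Fin n) (Fin n) 𝕜}
    {E : Matrix (Fin n) (Fin n) 𝕜} (hE : E * E = E) (hA : ∀ k, (1 - E) * A k * E = 0) :
    ¬ Tendsto (jointDiagFunctional A) (𝓝[{U | IsUnit U}] E) atTop := by
  intro h
  set U : 𝕜 → Matrix (Fin n) (Fin n) 𝕜 := fun t => E + t • (1 - E) with hUdef
  have hQ : (1 - E) * (1 - E) = 1 - E := by
    simp [sub_mul, mul_sub, hE]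
  have hEQ : E * (1 - E) = 0 := by simp [mul_sub, hE]
  have hQE : (1 - E) * E = 0 := by simp [sub_mul, hE]
  have hmul : ∀ t : 𝕜, t ≠ 0 → (E + t⁻¹ • (1 - E)) * U t = 1 := fun t ht => by
    simp only [hUdef, add_mul, mul_add, smul_mul_assoc, mul_smul_comm, hE, hEQ, hQE, hQ, smul_zero,
      add_zero, zero_add, smul_smul, mul_inv_cancel₀ ht, one_smul, add_sub_cancel]
  have hcont : Continuous U := by fun_prop
  have hUt : Tendsto U (𝓝[≠] 0) (𝓝[{U | IsUnit U}] E) := by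
    refine tendsto_nhdsWithin_iff.2 ⟨?_, ?_⟩
    · have := (hcont.tendsto 0).mono_left (nhdsWithin_le_nhds (s := {(0 : 𝕜)}ᶜ))
      simpa [hUdef] using this
    · filter_upwards [self_mem_nhdsWithin] with t ht
      exact IsUnit.of_mul_eq_one_right _ (hmul t ht)
  set g : 𝕜 → ℝ := fun t => (1 / 2 : ℝ) * ∑ k : Fin K, ∑ i : Fin n, ∑ j : Fin n,
    if i ≠ j then ‖(E * A k * E + (1 - E) * A k * (1 - E) + t • (E * A k * (1 - E))) i j‖ ^ 2
      else 0 with hg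
  have hgc : Continuous g := by
    refine continuous_const.mul (continuous_finsetSum _ fun k _ => continuous_finsetSum _
      fun i _ => continuous_finsetSum _ fun j _ => ?_)
    split_ifs
    · simp only [Matrix.add_apply, Matrix.smul_apply]
      fun_prop
    · exact continuous_const
  have heq : ∀ t : 𝕜, t ≠ 0 → jointDiagFunctional A (U t) = g t := fun t ht => by
    have hconj : ∀ k, (U t)⁻¹ * A k * U t =
        E * A k * E + (1 - E) * A k * (1 - E) + t • (E * A k * (1 - E)) := fun k => by
      rw [Matrix.inv_eq_left_inv (hmul t ht)]
      simp only [hUdef, add_mul, mul_add, smul_mul_assoc, mul_smul_comm, hA, smul_zero, smul_add, smul_smul,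
        mul_inv_cancel₀ ht, one_smul]
      abel
    simp only [jointDiagFunctional, hg, hconj]
  refine not_tendsto_nhds_of_tendsto_atTop (h.comp hUt) (g 0) ?_
  refine ((hgc.tendsto 0).mono_left nhdsWithin_le_nhds).congr' ?_
  filter_upwards [self_mem_nhdsWithin] with t ht
  exact (heq t ht).symm

theorem mainTheorem4 {𝕜 : Type*} [RCLike 𝕜] {n K : ℕ}
    (A : Fin K → Matrix (Fin n) (Fin n) 𝕜) :
    (∀ U₀ : Matrix (Fin n) (Fin n) 𝕜, U₀ ≠ 0 → ¬ IsUnit U₀ →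
      Tendsto (jointDiagFunctional A) (𝓝[{U | IsUnit U}] U₀) atTop) ↔
    ¬ HasCommonNontrivialInvariantSubspace A := by
  refine ⟨?_, fun hA U₀ h0 hU₀ =>
    tendsto_jointDiagFunctional_of_not_hasCommonNontrivialInvariantSubspace hA h0 hU₀⟩
  rintro h ⟨W, hbot, htop, hW⟩
  obtain ⟨E, hE, hE0, hE1, hEA⟩ := exists_idempotent_of_mem_invtSubmodule hbot htop
  refine not_tendsto_jointDiagFunctional_of_idempotent hE (fun k => hEA (A k) (hW k))
    (h E hE0 fun hu => hE1 (hu.mul_left_cancel ?_))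
  rw [hE, mul_one]
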